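/- A C*-probability space with faithful trace is a pair $(\mathcal A,\tau)$ of a unital C*-algebra $\mathcal A$ and a linear functional $\tau:\mathcal A\to\mathbb C$ with $\tau(1)=1$, $\tau(a^*a)\ge 0$, $\tau(ab)=\tau(ba)$, and $\tau(a^*a)=0\Rightarrow a=0$. An element $s\in\mathcal A$ is a (standard) semicircle if $s=s^*$ and $\tau(s^n)=\frac1{2\pi}\int_{-2}^{2}x^n\sqrt{4-x^2}\,dx$ for all integers $n\ge 0$. Let $G$ be a finite simple graph with vertex set $V$. Semicircles $(s_i)_{i\in V}$ in $(\mathcal A,\tau)$ are $G$-independent if the unital subalgebras $\mathcal A_i$ generated by $s_i$ satisfy: (a) if $i,j$ are adjacent in $G$, then $ab=ba$ for all $a\in\mathcal A_i$, $b\in\mathcal A_j$, and moreover $\tau(ab)=0$ whenever $\tau(a)=\tau(b)=0$; (b) for all $k\ge 1$ and $i_1,\dots,i_k\in V$ such that whenever $j_1<j_2$ and $i_{j_1}=i_{j_2}$ there is $j_3$ with $j_1<j_3<j_2$ and $i_{j_1},i_{j_3}$ not adjacent in $G$, one has $\tau(a_1\cdots a_k)=0$ for all $a_j\in\mathcal A_{i_j}$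 with $\tau(a_j)=0$ $(1\le j\le k)$. For a graph $G$ on $L\ge1$ vertices, let $T_G=\frac1{\sqrt L}\sum_{i\in V}s_i$, where $(s_i)_{i\in V}$ are $G$-independent semicircles in some C*-probability space with faithful trace, and let $\|T_G\|$ be its C*-norm. **Proposition 1.3.** Let $1\le\omega\le L$ be integers and let $N$ be the disjoint union of the complete graph $K_\omega$ on $\omega$ vertices and the edgeless graph on $L-\omega$ vertices. Then $N$ has clique number $\omega$, and for every graph $G$ on $L$ vertices with clique number $\omega$, $$\|T_G\|\ \ge\ \|T_N\|,$$ whichever C*-probability spaces with faithful trace and whichever $G$-independent, respectively $N$-independent, semicircles in them are used to form $T_G$ and $T_N$. Moreover, $$\sqrt{\frac{\omega^2+L-\omega}{L}}\ \le\ \|T_N\|\ \le\ 2\sqrt{\frac{\omega^2+L-\omega}{L}}.$$ -/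

import Mathlib

open scoped ComplexOrder

/-- `τ` is a faithful tracial state on the unital C*-algebra `A`, that is, `(A, τ)` is a
C*-probability space equipped with a faithful trace. -/
structure IsFaithfulTracialState {A : Type*} [CStarAlgebra A] (τ : A →ₗ[ℂ] ℂ) : Prop where
  map_one : τ 1 = 1
  nonneg : ∀ a : A, 0 ≤ τ (star a * a)
  tracial : ∀ a b : A, τ (a * b) = τ (b * a)
  faithful : ∀ a : A, τ (star a * a) = 0 → a = 0

/-- `s` is a standard (mean `0`, variance `1`) semicircular element: it is self-adjoint and its
moments are those of the density `√(4 - t²) / (2π)` on `[-2, 2]`. -/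
structure IsSemicircular {A : Type*} [CStarAlgebra A] (τ : A →ₗ[ℂ] ℂ) (s : A) : Prop where
  selfAdjoint : IsSelfAdjoint s
  moment : ∀ n : ℕ,
    τ (s ^ n) = (((1 / (2 * Real.pi)) * ∫ t in (-2 : ℝ)..2, t ^ n * √(4 - t ^ 2) : ℝ) : ℂ)

/-- Classical independence of two unital subalgebras: they commute, and products of centered
elements are centered. -/
structure IsClassicallyIndep {A : Type*} [CStarAlgebra A] (τ : A →ₗ[ℂ] ℂ)
    (P Q : Subalgebra ℂ A) : Prop where
  commute : ∀ a ∈ P, ∀ b ∈ Q, a * b = b * a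
  centered : ∀ a ∈ P, ∀ b ∈ Q, τ a = 0 → τ b = 0 → τ (a * b) = 0

/-- `G`-independence of a family of unital subalgebras indexed by the vertices of `G`. -/
structure IsGIndep {A : Type*} [CStarAlgebra A] (τ : A →ₗ[ℂ] ℂ) {V : Type*}
    (G : SimpleGraph V) (P : V → Subalgebra ℂ A) : Prop where
  indep_of_adj : ∀ i j : V, G.Adj i j → IsClassicallyIndep τ (P i) (P j)
  centered : ∀ k : ℕ, 1 ≤ k → ∀ i : Fin k → V,
    (∀ j₁ j₂ : Fin k, j₁ < j₂ → i j₁ = i j₂ →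
      ∃ j₃ : Fin k, j₁ < j₃ ∧ j₃ < j₂ ∧ ¬ G.Adj (i j₁) (i j₃)) →
    ∀ a : Fin k → A, (∀ j, a j ∈ P (i j)) → (∀ j, τ (a j) = 0) →
      τ (List.ofFn a).prod = 0

/-- `(s i)` is a family of `G`-independent standard semicircular elements of `(A, τ)`:
each `s i` is semicircular, and the unital subalgebras that they generate are `G`-independent. -/
structure IsGIndepSemicircular {A : Type*} [CStarAlgebra A] (τ : A →ₗ[ℂ] ℂ) {V : Type*}
    (G : SimpleGraph V) (s : V → A) : Prop where
  semicircular : ∀ i, IsSemicircular τ (s i)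
  indep : IsGIndep τ G (fun i => Algebra.adjoin ℂ {s i})

/-- The normalized sum `L^{-1/2} ∑ᵢ sᵢ`, where `L` is the number of indices. -/
noncomputable def normalizedSum {A : Type*} [CStarAlgebra A] {V : Type*} [Fintype V]
    (s : V → A) : A :=
  ((1 / √(Fintype.card V : ℝ) : ℝ) : ℂ) • ∑ i, s i

/-- The disjoint union of the complete graph on `ω` vertices and the edgeless graph on `L - ω`
vertices (used for `ω ≤ L`). -/
def cliqueWithIsolated (L ω : ℕ) : SimpleGraph (Fin ω ⊕ Fin (L - ω)) :=
  (⊤ : SimpleGraph (Fin ω)) ⊕g (⊥ : SimpleGraph (Fin (L - ω)))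

/-! Each word in the vertices carries an element `chebyshevWord`, built from Chebyshev polynomials
of the generators. Left multiplication by `s i` sends the element of `w` to that of `i :: w` plus,
when some `i` can be commuted to the front of `w`, that of `w` with this letter removed.
`G`-independence makes `τ` vanish on nonempty words, so the `n`-th moment of `∑ i, s i` is the
number `walkCount n []` of closed walks at the empty word (`apply_sum_pow`). As `τ` is faithful, the
norm is the exponential growth rate of these counts (`apply_pow_le`, `norm_le_of_apply_pow_le`) and
depends on the graph alone.

Extra edges only allow more removals, so the counts grow with the graph (`walkCount_le_of_equiv`).
Keeping only the edges inside a maximum clique of `G` leaves a copy of `N`; hence the comparison.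

The two bounds are Perron-Frobenius arguments. A positive supersolution of the walk recursion,
multiplicative in the letters, gives the upper one. Finitely supported subsolutions, one on isolated
letters and one on clique letters, give `√(2 (L - ω))` and `√2 ω`, and the larger of these is
enough. -/

open Polynomial

/-! ### Words up to commutation, and walks on them -/

namespace SimpleGraph

variable {V W : Type*} (G : SimpleGraph V)

open Classical in
/-- Remove the first occurrence of the letter `i` in a word, provided that all letters in front of
it are adjacent to `i` in `G`, so that `i` can be moved to the front by commutations. -/
noncomputable def eraseHead (i : V) : List V → Option (List V)
  | [] => none
  | a :: x => if a = i then some x else if G.Adj i a then (eraseHead i x).map (a :: ·) else none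

@[simp] lemma eraseHead_nil (i : V) : G.eraseHead i [] = none := rfl

@[simp] lemma eraseHead_cons_self (i : V) (x : List V) : G.eraseHead i (i :: x) = some x := by
  simp [eraseHead]

lemma eraseHead_cons_of_adj {i a : V} (h : G.Adj i a) (x : List V) :
    G.eraseHead i (a :: x) = (G.eraseHead i x).map (a :: ·) := by
  simp [eraseHead, h, h.ne']

lemma eraseHead_cons_of_not_adj {i a : V} (hne : a ≠ i) (h : ¬ G.Adj i a) (x : List V) :
    G.eraseHead i (a :: x) = none := by
  simp [eraseHead, h, hne]

lemma perm_of_eraseHead {i : V} {x y : List V} (h : G.eraseHead i x = some y) :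
    x.Perm (i :: y) := by
  induction x generalizing y with
  | nil => simp at h
  | cons a x ih =>
    by_cases ha : a = i
    · subst ha
      simp only [eraseHead_cons_self, Option.some.injEq] at h
      rw [h]
    · by_cases hadj : G.Adj i a
      · rw [G.eraseHead_cons_of_adj hadj, Option.map_eq_some_iff] at h
        obtain ⟨z, hz, rfl⟩ := h
        exact ((ih hz).cons a).trans (List.Perm.swap i a z)
      · simp [G.eraseHead_cons_of_not_adj ha hadj] at h

lemma length_of_eraseHead {i : V} {x y : List V} (h : G.eraseHead i x = some y) :
    y.length + 1 = x.length := by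
  simpa using (G.perm_of_eraseHead h).length_eq.symm

lemma exists_eraseHead {i : V} {x : List V} (hi : i ∈ x) (h : ∀ a ∈ x, a ≠ i → G.Adj i a) :
    ∃ y, G.eraseHead i x = some y := by
  induction x with
  | nil => simp at hi
  | cons a x ih =>
    by_cases ha : a = i
    · subst ha
      exact ⟨x, by simp⟩
    · obtain ⟨y, hy⟩ := ih (by simpa [Ne.symm ha] using hi) fun b hb => h b (by simp [hb])
      exact ⟨a :: y, by simp [G.eraseHead_cons_of_adj (h a (by simp) ha), hy]⟩

/-- Adjacent letters do not block each other, so the two removals commute as partial maps, undefined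
cases included. -/
lemma eraseHead_bind_comm {i j : V} (h : G.Adj i j) (x : List V) :
    (G.eraseHead i x).bind (G.eraseHead j) = (G.eraseHead j x).bind (G.eraseHead i) := by
  induction x with
  | nil => simp
  | cons a x ih =>
    by_cases hai : a = i
    · subst hai
      rw [G.eraseHead_cons_of_adj h.symm]
      cases h1 : G.eraseHead j x <;> simp [h1]
    by_cases haj : a = j
    · subst haj
      rw [G.eraseHead_cons_of_adj h]
      cases h1 : G.eraseHead i x <;> simp [h1]
    by_cases hi : G.Adj i a <;> by_cases hj : G.Adj j a
    · rw [G.eraseHead_cons_of_adj hi, G.eraseHead_cons_of_adj hj]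
      have h' (o : Option (List V)) (k : V) (hk : G.Adj k a) :
          (o.map (a :: ·)).bind (G.eraseHead k) = (o.bind (G.eraseHead k)).map (a :: ·) := by
        cases o <;> simp [G.eraseHead_cons_of_adj hk]
      rw [h' _ j hj, h' _ i hi, ih]
    · rw [G.eraseHead_cons_of_adj hi, G.eraseHead_cons_of_not_adj haj hj]
      cases G.eraseHead i x <;> simp [G.eraseHead_cons_of_not_adj haj hj]
    · rw [G.eraseHead_cons_of_adj hj, G.eraseHead_cons_of_not_adj hai hi]
      cases G.eraseHead j x <;> simp [G.eraseHead_cons_of_not_adj hai hi]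
    · rw [G.eraseHead_cons_of_not_adj haj hj, G.eraseHead_cons_of_not_adj hai hi]
      rfl

/-- Complements `eraseHead_bind_comm`: if both single removals are defined, so is the double one. -/
lemma eraseHead_diamond {i j : V} (h : G.Adj i j) {x y z : List V} (hy : G.eraseHead i x = some y)
    (hz : G.eraseHead j x = some z) :
    ∃ u, G.eraseHead j y = some u ∧ G.eraseHead i z = some u := by
  induction x generalizing y z with
  | nil => simp at hy
  | cons a x ih =>
    by_cases hai : a = i
    · subst hai
      rw [G.eraseHead_cons_of_adj h.symm, Option.map_eq_some_iff] at hz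
      obtain ⟨w, hw, rfl⟩ := hz
      simp only [eraseHead_cons_self, Option.some.injEq] at hy
      exact ⟨w, hy ▸ hw, by simp⟩
    by_cases haj : a = j
    · subst haj
      rw [G.eraseHead_cons_of_adj h, Option.map_eq_some_iff] at hy
      obtain ⟨w, hw, rfl⟩ := hy
      simp only [eraseHead_cons_self, Option.some.injEq] at hz
      exact ⟨w, by simp, hz ▸ hw⟩
    by_cases hi : G.Adj i a
    swap
    · simp [G.eraseHead_cons_of_not_adj hai hi] at hy
    by_cases hj : G.Adj j a
    swap
    · simp [G.eraseHead_cons_of_not_adj haj hj] at hz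
    rw [G.eraseHead_cons_of_adj hi, Option.map_eq_some_iff] at hy
    rw [G.eraseHead_cons_of_adj hj, Option.map_eq_some_iff] at hz
    obtain ⟨y', hy', rfl⟩ := hy
    obtain ⟨z', hz', rfl⟩ := hz
    obtain ⟨u, hu1, hu2⟩ := ih hy' hz'
    exact ⟨a :: u, by simp [G.eraseHead_cons_of_adj hj, hu1],
      by simp [G.eraseHead_cons_of_adj hi, hu2]⟩

lemma eraseHead_map {G : SimpleGraph V} {H : SimpleGraph W} (f : V → W)
    (hf : ∀ i j, G.Adj i j → H.Adj (f i) (f j)) {i : V} {x y : List V}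
    (h : G.eraseHead i x = some y) : H.eraseHead (f i) (x.map f) = some (y.map f) := by
  induction x generalizing y with
  | nil => simp at h
  | cons a x ih =>
    by_cases ha : a = i
    · subst ha
      simp only [eraseHead_cons_self, Option.some.injEq] at h
      simp [h]
    · by_cases hadj : G.Adj i a
      · rw [G.eraseHead_cons_of_adj hadj, Option.map_eq_some_iff] at h
        obtain ⟨z, hz, rfl⟩ := h
        simp [H.eraseHead_cons_of_adj (hf _ _ hadj), ih hz]
      · simp [G.eraseHead_cons_of_not_adj ha hadj] at h

/-- A word is reduced if none of its letters can be moved next to an earlier equal letter. -/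
def IsReducedWord : List V → Prop
  | [] => True
  | a :: x => G.eraseHead a x = none ∧ IsReducedWord x

lemma exists_not_adj_of_eraseHead_eq_none {a : V} {x : List V} (h : G.eraseHead a x = none)
    {m : ℕ} (hm : m < x.length) (ha : x[m] = a) :
    ∃ m', ∃ h' : m' < m, ¬ G.Adj a (x[m']'(h'.trans hm)) := by
  induction x generalizing m with
  | nil => simp at hm
  | cons c x ih =>
    cases m with
    | zero =>
      simp only [List.getElem_cons_zero] at ha
      subst ha
      simp at h
    | succ m =>
      by_cases hadj : G.Adj a c
      · rw [G.eraseHead_cons_of_adj hadj, Option.map_eq_none_iff] at h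
        obtain ⟨m', h', hn⟩ := ih h (by simpa using hm) (by simpa using ha)
        exact ⟨m' + 1, by omega, by simpa using hn⟩
      · exact ⟨0, by omega, by simpa using hadj⟩

/-- Puts reducedness in the form of the index condition in `IsGIndep.centered`. -/
lemma IsReducedWord.exists_not_adj {x : List V} (hx : G.IsReducedWord x) {p q : ℕ} (hpq : p < q)
    (hq : q < x.length) (h : x[p] = x[q]) :
    ∃ m, ∃ _ : p < m, ∃ h' : m < q, ¬ G.Adj x[p] (x[m]'(h'.trans hq)) := by
  induction x generalizing p q with
  | nil => simp at hq
  | cons c x ih =>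
    obtain ⟨q, rfl⟩ := Nat.exists_eq_add_one_of_ne_zero (show q ≠ 0 by omega)
    cases p with
    | zero =>
      obtain ⟨m, hm, hn⟩ := G.exists_not_adj_of_eraseHead_eq_none hx.1 (m := q)
        (by simpa using hq) (by simpa using h.symm)
      exact ⟨m + 1, by omega, by omega, by simpa using hn⟩
    | succ p =>
      obtain ⟨m, h1, h2, hn⟩ := ih hx.2 (p := p) (q := q) (by omega) (by simpa using hq)
        (by simpa using h)
      exact ⟨m + 1, by omega, by omega, by simpa using hn⟩

/-- The number of walks of length `n` from the word `u` to the empty word, where a step either adds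
a letter in front or removes an accessible letter. -/
noncomputable def walkCount [Fintype V] : ℕ → List V → ℕ
  | 0, u => if u.length = 0 then 1 else 0
  | n + 1, u => ∑ i, (walkCount n (i :: u) + (G.eraseHead i u).elim 0 (walkCount n))

lemma one_le_walkCount_length [Fintype V] (u : List V) : 1 ≤ G.walkCount u.length u := by
  induction u with
  | nil => simp [walkCount]
  | cons a u ih =>
    rw [List.length_cons, walkCount]
    refine le_trans ?_ (Finset.single_le_sum (fun i _ => Nat.zero_le _) (Finset.mem_univ a))
    simp only [eraseHead_cons_self, Option.elim_some]
    omega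

/-- A removal possible in `G` stays possible in `H` after relabelling, so walks for `G` inject into
walks for `H`. -/
lemma walkCount_le_of_equiv [Fintype V] [Fintype W] {G : SimpleGraph V} {H : SimpleGraph W}
    (e : V ≃ W) (he : ∀ i j, G.Adj i j → H.Adj (e i) (e j)) (n : ℕ) (u : List V) :
    G.walkCount n u ≤ H.walkCount n (u.map e) := by
  induction n generalizing u with
  | zero => simp [walkCount]
  | succ n ih =>
    rw [walkCount, walkCount, ← e.sum_comp]
    refine Finset.sum_le_sum fun i _ => add_le_add (by simpa using ih (i :: u)) ?_
    cases h : G.eraseHead i u with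
    | none => simp
    | some v => simpa [eraseHead_map e he h] using ih v

/-- Words weighted by a supersolution of the walk recursion have at most geometric growth. -/
lemma walkCount_le_of_supersolution [Fintype V] (h : List V → ℝ) (μ : ℝ) (hμ : 0 ≤ μ)
    (h0 : ∀ u, 0 ≤ h u) (h1 : 1 ≤ h [])
    (hstep : ∀ u, ∑ i, (h (i :: u) + (G.eraseHead i u).elim 0 h) ≤ μ * h u) (n : ℕ)
    (u : List V) : (G.walkCount n u : ℝ) ≤ μ ^ n * h u := by
  induction n generalizing u with
  | zero =>
    cases u with
    | nil => simpa [walkCount] using h1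
    | cons a u => simpa [walkCount] using h0 _
  | succ n ih =>
    rw [walkCount, pow_succ, mul_assoc]
    push_cast
    refine le_trans ?_ (mul_le_mul_of_nonneg_left (hstep u) (pow_nonneg hμ n))
    rw [Finset.mul_sum]
    refine Finset.sum_le_sum fun i _ => ?_
    rw [mul_add]
    refine add_le_add (ih _) ?_
    cases G.eraseHead i u with
    | none => simp
    | some v => simpa using ih v

/-- A finitely supported subsolution of the walk recursion forces geometric growth. -/
lemma le_walkCount_of_subsolution [Fintype V] (h : List V → ℝ) (μ H : ℝ) (hμ : 0 ≤ μ) (K : ℕ)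
    (hH : 0 ≤ H) (h0 : ∀ u, h u ≤ H) (hK : ∀ u, K < u.length → h u ≤ 0)
    (hstep : ∀ u, μ * h u ≤ ∑ i, (h (i :: u) + (G.eraseHead i u).elim 0 h)) (n : ℕ)
    (u : List V) : μ ^ n * h u ≤ H * ∑ k ∈ Finset.range (K + 1), (G.walkCount (n + k) u : ℝ) := by
  induction n generalizing u with
  | zero =>
    have hs : (0 : ℝ) ≤ ∑ k ∈ Finset.range (K + 1), (G.walkCount (0 + k) u : ℝ) :=
      Finset.sum_nonneg fun _ _ => Nat.cast_nonneg _
    rw [pow_zero, one_mul]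
    rcases lt_or_ge K u.length with hu | hu
    · exact (hK u hu).trans (mul_nonneg hH hs)
    -- A word of length `k ≤ K` reaches the empty word by `k` successive removals; the sum over `k`
    -- covers all these lengths at once.
    · refine (h0 u).trans (le_mul_of_one_le_right hH ?_)
      refine le_trans ?_ (Finset.single_le_sum
        (f := fun k => (G.walkCount (0 + k) u : ℝ)) (fun _ _ => Nat.cast_nonneg _)
        (Finset.mem_range.2 (Nat.lt_succ_of_le hu)))
      simpa using G.one_le_walkCount_length u
  | succ n ih =>
    calc μ ^ (n + 1) * h u = μ ^ n * (μ * h u) := by ring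
      _ ≤ μ ^ n * ∑ i, (h (i :: u) + (G.eraseHead i u).elim 0 h) :=
        mul_le_mul_of_nonneg_left (hstep u) (pow_nonneg hμ n)
      _ = ∑ i, (μ ^ n * h (i :: u) + (G.eraseHead i u).elim 0 (fun v => μ ^ n * h v)) := by
        rw [Finset.mul_sum]
        refine Finset.sum_congr rfl fun i _ => ?_
        cases G.eraseHead i u <;> simp [mul_add]
      _ ≤ ∑ i, (H * ∑ k ∈ Finset.range (K + 1), (G.walkCount (n + k) (i :: u) : ℝ) +
            H * ∑ k ∈ Finset.range (K + 1),
              (((G.eraseHead i u).elim 0 (G.walkCount (n + k)) : ℕ) : ℝ)) := by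
        refine Finset.sum_le_sum fun i _ => add_le_add (ih _) ?_
        cases G.eraseHead i u with
        | none => simp
        | some v => simpa using ih v
      _ = H * ∑ k ∈ Finset.range (K + 1), (G.walkCount (n + 1 + k) u : ℝ) := by
        simp_rw [← mul_add, ← Finset.sum_add_distrib]
        rw [← Finset.mul_sum, Finset.sum_comm]
        congr 1
        refine Finset.sum_congr rfl fun k _ => ?_
        rw [show n + 1 + k = (n + k) + 1 by omega, walkCount]
        push_cast
        rfl

end SimpleGraph

/-! ### Chebyshev polynomials of a semicircular element are centered -/

section Semicircular

lemma integral_cos_nat_mul_zero_pi {m : ℕ} (hm : m ≠ 0) :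
    ∫ θ in (0 : ℝ)..Real.pi, Real.cos (m * θ) = 0 := by
  rw [intervalIntegral.integral_comp_mul_left (fun x => Real.cos x) (Nat.cast_ne_zero.2 hm)]
  simp

/-- Substitute `t = 2 cos θ`: since `S_k(2 cos θ) sin θ = sin ((k + 1) θ)`, the integrand becomes a
difference of cosines of the nonzero frequencies `k + 2` and `k`, which integrate to zero over `[0,
π]`. -/
lemma integral_chebyshevS_mul_sqrt {k : ℕ} (hk : k ≠ 0) :
    ∫ t in (-2 : ℝ)..2, (Chebyshev.S ℝ k).eval t * √(4 - t ^ 2) = 0 := by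
  have h := intervalIntegral.integral_comp_mul_deriv (a := Real.pi) (b := 0)
    (f := fun θ => 2 * Real.cos θ) (f' := fun θ => 2 * -Real.sin θ)
    (g := fun t => (Chebyshev.S ℝ k).eval t * √(4 - t ^ 2))
    (fun x _ => (Real.hasDerivAt_cos x).const_mul 2) (by fun_prop) (by fun_prop)
  simp only [Real.cos_pi, Real.cos_zero, mul_one] at h
  rw [show (2 : ℝ) * -1 = -2 by norm_num] at h
  rw [← h, intervalIntegral.integral_symm]
  have key : ∀ θ ∈ Set.uIcc 0 Real.pi,
      ((fun t => (Chebyshev.S ℝ k).eval t * √(4 - t ^ 2)) ∘ fun θ => 2 * Real.cos θ) θ *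
        (2 * -Real.sin θ) =
      2 * Real.cos ((k + 2 : ℕ) * θ) - 2 * Real.cos (k * θ) := by
    intro θ hθ
    rw [Set.uIcc_of_le Real.pi_pos.le] at hθ
    have hs := Real.sin_nonneg_of_nonneg_of_le_pi hθ.1 hθ.2
    have h1 : √(4 - (2 * Real.cos θ) ^ 2) = 2 * Real.sin θ := by
      rw [show 4 - (2 * Real.cos θ) ^ 2 = (2 * Real.sin θ) ^ 2 by
        nlinarith [Real.sin_sq_add_cos_sq θ], Real.sqrt_sq (by positivity)]
    have h2 := Chebyshev.S_two_mul_real_cos θ k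
    have e1 : ((k + 2 : ℕ) : ℝ) * θ = (k + 1) * θ + θ := by push_cast; ring
    have e2 : (k : ℝ) * θ = (k + 1) * θ - θ := by ring
    simp only [Function.comp_apply, h1]
    rw [e1, e2, Real.cos_add, Real.cos_sub]
    push_cast at h2
    linear_combination (-4 * Real.sin θ) * h2
  rw [intervalIntegral.integral_congr key, intervalIntegral.integral_sub
    (by apply Continuous.intervalIntegrable; fun_prop)
    (by apply Continuous.intervalIntegrable; fun_prop),
    intervalIntegral.integral_const_mul, intervalIntegral.integral_const_mul,
    integral_cos_nat_mul_zero_pi (by omega), integral_cos_nat_mul_zero_pi hk]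
  simp

variable {A : Type*} [CStarAlgebra A] {τ : A →ₗ[ℂ] ℂ}

lemma IsSemicircular.apply_aeval {s : A} (hs : IsSemicircular τ s) (p : ℝ[X]) :
    τ (aeval s (p.map Complex.ofRealHom)) =
      (((1 / (2 * Real.pi)) * ∫ t in (-2 : ℝ)..2, p.eval t * √(4 - t ^ 2) : ℝ) : ℂ) := by
  induction p using Polynomial.induction_on' with
  | add p q hp hq =>
    rw [Polynomial.map_add, map_add, map_add, hp, hq, ← Complex.ofReal_add, ← mul_add,
      ← intervalIntegral.integral_add (by apply Continuous.intervalIntegrable; fun_prop)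
        (by apply Continuous.intervalIntegrable; fun_prop)]
    simp [add_mul]
  | monomial n a =>
    rw [Polynomial.map_monomial, aeval_monomial, ← Algebra.smul_def, map_smul, hs.moment]
    simp only [eval_monomial, mul_assoc, intervalIntegral.integral_const_mul]
    push_cast
    simp only [Complex.ofRealHom_eq_coe, smul_eq_mul]
    ring

lemma IsSemicircular.apply_chebyshevS {s : A} (hs : IsSemicircular τ s) {k : ℕ} (hk : k ≠ 0) :
    τ (aeval s (Chebyshev.S ℂ k)) = 0 := by
  rw [← Chebyshev.map_S Complex.ofRealHom, hs.apply_aeval, integral_chebyshevS_mul_sqrt hk]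
  simp

end Semicircular

/-! ### The norm as growth rate of moments -/

section Norm

variable {A : Type*} [CStarAlgebra A] {τ : A →ₗ[ℂ] ℂ}

lemma le_of_forall_pow_le {μ r c C : ℝ} (hr : 0 ≤ r) (hc : 0 < c)
    (h : ∀ n : ℕ, μ ^ n * c ≤ C * r ^ n) : μ ≤ r := by
  by_contra! hlt
  have hμ : 0 < μ := hr.trans_lt hlt
  have ht : Filter.Tendsto (fun n : ℕ => C * (r / μ) ^ n) Filter.atTop (nhds (C * 0)) :=
    (tendsto_pow_atTop_nhds_zero_of_lt_one (by positivity) ((div_lt_one hμ).2 hlt)).const_mul C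
  have : c ≤ C * 0 := ge_of_tendsto' ht fun n => by
    rw [div_pow, ← mul_div_assoc, le_div_iff₀ (pow_pos hμ n)]
    linarith [h n]
  linarith

lemma IsFaithfulTracialState.cfc_nonneg (hτ : IsFaithfulTracialState τ) {T : A}
    (f : ℝ → ℝ) (hf : Continuous f) (h : ∀ x ∈ spectrum ℝ T, 0 ≤ f x) :
    0 ≤ τ (cfc f T) := by
  have e : cfc f T = star (cfc (fun x => √(f x)) T) * cfc (fun x => √(f x)) T := by
    rw [(cfc_predicate (p := IsSelfAdjoint) (fun x => √(f x)) T).star_eq,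
      ← cfc_mul (fun x => √(f x)) (fun x => √(f x)) T (by fun_prop) (by fun_prop)]
    exact cfc_congr fun x hx => (Real.mul_self_sqrt (h x hx)).symm
  rw [e]
  exact hτ.nonneg _

lemma IsFaithfulTracialState.cfc_mono (hτ : IsFaithfulTracialState τ) {T : A}
    {f g : ℝ → ℝ} (hf : Continuous f) (hg : Continuous g)
    (h : ∀ x ∈ spectrum ℝ T, f x ≤ g x) : τ (cfc f T) ≤ τ (cfc g T) := by
  have := hτ.cfc_nonneg (T := T) (fun x => g x - f x) (by fun_prop)
    fun x hx => sub_nonneg.2 (h x hx)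
  rw [cfc_sub g f T (by fun_prop) (by fun_prop), map_sub] at this
  exact sub_nonneg.1 this

lemma IsFaithfulTracialState.nontrivial (hτ : IsFaithfulTracialState τ) : Nontrivial A :=
  ⟨1, 0, fun h => by simpa [h] using hτ.map_one⟩

lemma IsFaithfulTracialState.apply_pow_le (hτ : IsFaithfulTracialState τ) {T : A}
    (hT : IsSelfAdjoint T) (n : ℕ) : (τ (T ^ n)).re ≤ ‖T‖ ^ n := by
  have := hτ.nontrivial
  have h := hτ.cfc_mono (T := T) (f := fun x => x ^ n) (g := fun _ => ‖T‖ ^ n) (by fun_prop)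
    (by fun_prop) fun x hx => by
      refine (le_abs_self _).trans ?_
      rw [abs_pow]
      exact pow_le_pow_left₀ (abs_nonneg x) (spectrum.norm_le_norm_of_mem hx) n
  rw [cfc_pow_id T n, cfc_const _ T hT, IsScalarTower.algebraMap_apply ℝ ℂ A,
    Algebra.algebraMap_eq_smul_one, map_smul, hτ.map_one] at h
  have h1 := (Complex.le_def.1 h).1
  rwa [Complex.coe_algebraMap, smul_eq_mul, mul_one, Complex.ofReal_re] at h1

/-- For `r' > r` let `f x = max (|x| - r') 0`. On the spectrum `r' ^ (2n) * f x ≤ ‖T‖ * x ^ (2n)`,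
so `τ (f(T))` is `O((r / r') ^ (2n))`, hence zero. Faithfulness gives `f(T) = 0`, so the spectrum
lies in `[-r', r']`. -/
lemma IsFaithfulTracialState.norm_le_of_apply_pow_le (hτ : IsFaithfulTracialState τ) {T : A}
    (hT : IsSelfAdjoint T) {r C : ℝ} (hr : 0 ≤ r) (h : ∀ n : ℕ, (τ (T ^ n)).re ≤ C * r ^ n) :
    ‖T‖ ≤ r := by
  have := hτ.nontrivial
  refine le_of_forall_gt_imp_ge_of_dense fun r' hr' => ?_
  have hr'0 : 0 < r' := hr.trans_lt hr'
  set f : ℝ → ℝ := fun x => max (|x| - r') 0 with hf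
  have hfc : Continuous f := by fun_prop
  have hf0 : ∀ x, 0 ≤ f x := fun x => le_max_right _ _
  set b := cfc (fun x => √(f x)) T with hb
  have hbs : IsSelfAdjoint b := cfc_predicate _ _
  have hbb : star b * b = cfc f T := by
    rw [hbs.star_eq, hb, ← cfc_mul (fun x => √(f x)) (fun x => √(f x)) T (by fun_prop)
      (by fun_prop)]
    exact cfc_congr fun x hx => Real.mul_self_sqrt (hf0 x)
  have hle : ∀ n : ℕ, (τ (cfc f T)).re * (r' ^ 2) ^ n ≤ (‖T‖ * C) * (r ^ 2) ^ n := by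
    intro n
    have h1 := hτ.cfc_mono (T := T) (f := fun x => r' ^ (2 * n) * f x)
      (g := fun x => ‖T‖ * x ^ (2 * n)) (by fun_prop) (by fun_prop) fun x hx => by
        have hx' : |x| ≤ ‖T‖ := spectrum.norm_le_norm_of_mem hx
        rcases le_total (|x|) r' with hxr | hxr
        · have : f x = 0 := max_eq_right (by linarith)
          rw [this, mul_zero, pow_mul]
          positivity
        · rw [mul_comm, show x ^ (2 * n) = |x| ^ (2 * n) by rw [pow_mul, pow_mul, sq_abs]]
          exact mul_le_mul (max_le (by linarith) (norm_nonneg T))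
            (pow_le_pow_left₀ hr'0.le hxr _) (by positivity) (norm_nonneg T)
    rw [cfc_const_mul _ _ T (by fun_prop), cfc_const_mul _ _ T (by fun_prop), cfc_pow_id T _,
      ← Complex.coe_smul, ← Complex.coe_smul, map_smul, map_smul] at h1
    have h2 := (Complex.le_def.1 h1).1
    simp only [smul_eq_mul, Complex.re_ofReal_mul] at h2
    have h3 := mul_le_mul_of_nonneg_left (h (2 * n)) (norm_nonneg T)
    rw [← pow_mul, ← pow_mul]
    linarith
  have hz : ¬ 0 < (τ (cfc f T)).re := by
    intro hpos
    have h1 : ∀ n : ℕ, (r' ^ 2) ^ n * (τ (cfc f T)).re ≤ (‖T‖ * C) * (r ^ 2) ^ n := fun n => by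
      rw [mul_comm]; exact hle n
    have := le_of_forall_pow_le (by positivity) hpos h1
    nlinarith
  have hτb := hτ.nonneg b
  have hb0 : b = 0 := by
    refine hτ.faithful b ?_
    have h1 := Complex.le_def.1 hτb
    rw [hbb] at h1 ⊢
    exact Complex.ext (le_antisymm (not_lt.1 hz) h1.1) h1.2.symm
  have hcf : cfc f T = 0 := by rw [← hbb, hb0, mul_zero]
  by_contra! hlt
  obtain ⟨x, hx, hxT⟩ : ∃ x ∈ spectrum ℝ T, |x| = ‖T‖ := by
    rcases CStarAlgebra.norm_or_neg_norm_mem_spectrum hT with h1 | h1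
    · exact ⟨_, h1, abs_of_nonneg (norm_nonneg T)⟩
    · exact ⟨_, h1, by simp⟩
  have h1 : f x ∈ spectrum ℝ (cfc f T) := by
    rw [cfc_map_spectrum f T]
    exact ⟨x, hx, rfl⟩
  rw [hcf, spectrum.zero_eq] at h1
  have h2 : f x = 0 := h1
  have h3 : |x| - r' ≤ f x := le_max_left _ _
  linarith

end Norm

/-! ### Chebyshev elements of words as reduced products -/

section ReducedProduct

variable {V : Type*} {A : Type*} [Ring A] (G : SimpleGraph V) (s : V → A)

/-- The element of the algebra attached to a word by the three-term recursion
`s i * E w = E (i :: w) + E (w with its accessible i removed)`. -/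
noncomputable def chebyshevWord : List V → A
  | [] => 1
  | i :: w =>
    match _h : G.eraseHead i w with
    | none => s i * chebyshevWord w
    | some u => s i * chebyshevWord w - chebyshevWord u
termination_by w => w.length
decreasing_by
  all_goals simp
  all_goals have := G.length_of_eraseHead _h; omega

/-- The element attached to a word, extended by `0` to the undefined word. -/
noncomputable abbrev chebyshevWordOption (o : Option (List V)) : A := o.elim 0 (chebyshevWord G s)

lemma chebyshevWord_cons (i : V) (w : List V) :
    chebyshevWord G s (i :: w) =
      s i * chebyshevWord G s w - chebyshevWordOption G s (G.eraseHead i w) := by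
  rw [chebyshevWord]
  split <;> rename_i h <;> simp [h]

lemma chebyshevWordOption_map_cons (i : V) (o : Option (List V)) :
    chebyshevWordOption G s (o.map (i :: ·)) =
      s i * chebyshevWordOption G s o - chebyshevWordOption G s (o.bind (G.eraseHead i)) := by
  cases o <;> simp [chebyshevWord_cons]

variable (hs : ∀ i j, G.Adj i j → s i * s j = s j * s i)
include hs

/-- Both sides expand into the same four terms; the double removal is symmetric by
`eraseHead_bind_comm`. -/
lemma chebyshevWord_swap {i j : V} (h : G.Adj i j) (w : List V) :
    chebyshevWord G s (i :: j :: w) = chebyshevWord G s (j :: i :: w) := by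
  rw [chebyshevWord_cons, chebyshevWord_cons G s j w, chebyshevWord_cons G s j (i :: w),
    chebyshevWord_cons G s i w, G.eraseHead_cons_of_adj h, G.eraseHead_cons_of_adj h.symm,
    chebyshevWordOption_map_cons, chebyshevWordOption_map_cons, G.eraseHead_bind_comm h,
    mul_sub, mul_sub, ← mul_assoc, ← mul_assoc, hs i j h]
  abel

lemma chebyshevWord_of_eraseHead {i : V} {w w' : List V} (h : G.eraseHead i w = some w') :
    chebyshevWord G s w = chebyshevWord G s (i :: w') := by
  induction hn : w.length using Nat.strong_induction_on generalizing w w' with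
  | _ n ih =>
    cases w with
    | nil => simp at h
    | cons a x =>
      by_cases ha : a = i
      · subst ha
        simp only [SimpleGraph.eraseHead_cons_self, Option.some.injEq] at h
        rw [h]
      by_cases hadj : G.Adj i a
      swap
      · simp [G.eraseHead_cons_of_not_adj ha hadj] at h
      rw [G.eraseHead_cons_of_adj hadj, Option.map_eq_some_iff] at h
      obtain ⟨x', hx', rfl⟩ := h
      rw [List.length_cons] at hn
      rw [chebyshevWord_swap G s hs hadj, chebyshevWord_cons, ih x.length (by omega) hx' rfl,
        chebyshevWord_cons G s a, G.eraseHead_cons_of_adj hadj.symm]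
      congr 1
      -- What remains is to match the subtracted terms, where `a` is removed. If `a` is accessible
      -- in `x`, this is the claim for the shorter word `y`, which need not be a tail of `x`; hence
      -- the strong induction.
      cases hy : G.eraseHead a x with
      | none =>
        have := G.eraseHead_bind_comm hadj x
        rw [hy, hx'] at this
        simp only [Option.bind_some, Option.bind_none] at this
        rw [this]
        rfl
      | some y =>
        obtain ⟨u, hu1, hu2⟩ := G.eraseHead_diamond hadj hx' hy
        have := G.length_of_eraseHead hy
        rw [hu1]
        exact ih y.length (by omega) hu2 rfl

omit hs in
lemma aeval_chebyshevS_add_one [Algebra ℂ A] (a : A) (k : ℤ) :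
    aeval a (Chebyshev.S ℂ (k + 1)) =
      a * aeval a (Chebyshev.S ℂ k) - aeval a (Chebyshev.S ℂ (k - 1)) := by
  rw [Chebyshev.S_add_one, map_sub, map_mul, aeval_X]

/-- Pulls every reachable `i` to the front, as if `w` were `i ^ k` followed by `w'`. The three-term
recursion needs degrees `k` and `k - 1` together; `S_{-1} = 0` covers `k = 0`. The last clause lets
accessibility be traced back from `w'` to `w`. -/
lemma exists_pull [Algebra ℂ A] (i : V) (w : List V) :
    ∃ (k : ℕ) (w' : List V), G.eraseHead i w' = none ∧ w'.length + k = w.length ∧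
      (G.eraseHead i w ≠ none → k ≠ 0) ∧
      chebyshevWord G s w = aeval (s i) (Chebyshev.S ℂ k) * chebyshevWord G s w' ∧
      chebyshevWordOption G s (G.eraseHead i w) =
        aeval (s i) (Chebyshev.S ℂ (k - 1)) * chebyshevWord G s w' ∧
      ∀ j, G.Adj i j → G.eraseHead j w' ≠ none → G.eraseHead j w ≠ none := by
  induction hn : w.length generalizing w with
  | zero =>
    obtain rfl := List.length_eq_zero_iff.1 hn
    exact ⟨0, [], by simp⟩
  | succ n ih =>
    cases h : G.eraseHead i w with
    | none => exact ⟨0, w, h, by simp [hn]⟩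
    | some v =>
      have hv := G.length_of_eraseHead h
      obtain ⟨k, w', h1, h2, -, h3, h4, h5⟩ := ih v (by omega)
      refine ⟨k + 1, w', h1, by omega, by simp, ?_, ?_, fun j hj hj' hw => ?_⟩
      · rw [chebyshevWord_of_eraseHead G s hs h, chebyshevWord_cons, h3, h4, Nat.cast_succ,
          aeval_chebyshevS_add_one, sub_mul, mul_assoc]
      · simpa using h3
      · refine h5 j hj hj' ?_
        have := G.eraseHead_bind_comm hj w
        rwa [h, hw] at this

/-- Every word equals a reduced product of Chebyshev polynomials of positive degree in the
generators. -/
lemma exists_reduced_product [Algebra ℂ A] (w : List V) :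
    ∃ l : List (V × ℕ), chebyshevWord G s w =
        (l.map fun b => aeval (s b.1) (Chebyshev.S ℂ (b.2 + 1 : ℕ))).prod ∧
      G.IsReducedWord (l.map Prod.fst) ∧
      (∀ j, G.eraseHead j (l.map Prod.fst) ≠ none → G.eraseHead j w ≠ none) ∧
      (w ≠ [] → l ≠ []) := by
  induction hn : w.length using Nat.strong_induction_on generalizing w with
  | _ n ih =>
    cases w with
    | nil => exact ⟨[], by simp [chebyshevWord, SimpleGraph.IsReducedWord]⟩
    | cons i w =>
      obtain ⟨k, w', h1, h2, h3, h4, -, h5⟩ := exists_pull G s hs i (i :: w)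
      -- The leading `i` is accessible, so the degree is positive; the list stores it minus one.
      obtain ⟨k, rfl⟩ := Nat.exists_eq_add_one_of_ne_zero (h3 (by simp))
      obtain ⟨l, l1, l2, l3, -⟩ := ih w'.length (by omega) w' rfl
      refine ⟨(i, k) :: l, ?_, ⟨?_, l2⟩, fun j hj => ?_, by simp⟩
      · rw [h4, l1, List.map_cons, List.prod_cons]
      -- An `i` accessible in the remaining blocks would be accessible in `w'`, from which all
      -- reachable ones were pulled.
      · by_contra hc
        exact l3 i hc h1
      · by_cases hji : i = j
        · subst hji
          simp
        · by_cases hadj : G.Adj i j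
          · refine h5 j hadj (l3 j fun hc => hj ?_)
            rw [List.map_cons, G.eraseHead_cons_of_adj hadj.symm, hc]
            rfl
          · exact absurd (G.eraseHead_cons_of_not_adj hji (fun hc => hadj hc.symm) _) hj

end ReducedProduct

/-! ### Moments of the sum as walk counts -/

section Moments

variable {V : Type*} [Fintype V] {A : Type*} [CStarAlgebra A] {τ : A →ₗ[ℂ] ℂ} {G : SimpleGraph V}
  {s : V → A}

omit [Fintype V] in
lemma IsGIndepSemicircular.commute (hs : IsGIndepSemicircular τ G s) (i j : V) (h : G.Adj i j) :
    s i * s j = s j * s i :=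
  (hs.indep.indep_of_adj i j h).commute _ (Algebra.self_mem_adjoin_singleton ℂ _) _
    (Algebra.self_mem_adjoin_singleton ℂ _)

omit [Fintype V] in
lemma IsGIndepSemicircular.apply_chebyshevWord (hs : IsGIndepSemicircular τ G s) {w : List V}
    (hw : w ≠ []) : τ (chebyshevWord G s w) = 0 := by
  obtain ⟨l, h1, h2, -, h4⟩ := exists_reduced_product G s hs.commute w
  have hl := List.length_pos_iff.2 (h4 hw)
  have key := hs.indep.centered l.length hl (fun j => l[j].1) (fun p q hpq h => by
      obtain ⟨m, m1, m2, m3⟩ := SimpleGraph.IsReducedWord.exists_not_adj G h2 (p := p) (q := q) hpq (by simp) (by simpa using h)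
      exact ⟨⟨m, m2.trans q.2⟩, m1, m2, by simpa using m3⟩)
    (fun j => aeval (s l[j].1) (Chebyshev.S ℂ (l[j].2 + 1 : ℕ)))
    (fun j => aeval_mem_adjoin_singleton ℂ _)
    (fun j => (hs.semicircular _).apply_chebyshevS (Nat.succ_ne_zero _))
  rw [h1]
  convert key using 3
  apply List.ext_getElem <;> simp

/-- By `chebyshevWord_cons`, multiplication by the sum acts on words as one walk step, and `τ`
detects only the empty word. -/
lemma IsGIndepSemicircular.apply_sum_pow_mul (hτ : IsFaithfulTracialState τ)
    (hs : IsGIndepSemicircular τ G s) (n : ℕ) (u : List V) :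
    τ ((∑ i, s i) ^ n * chebyshevWord G s u) = G.walkCount n u := by
  induction n generalizing u with
  | zero =>
    cases u with
    | nil => simp [chebyshevWord, SimpleGraph.walkCount, hτ.map_one]
    | cons a u => simp [SimpleGraph.walkCount, hs.apply_chebyshevWord]
  | succ n ih =>
    rw [pow_succ, mul_assoc, Finset.sum_mul, Finset.mul_sum, map_sum, SimpleGraph.walkCount,
      Nat.cast_sum]
    refine Finset.sum_congr rfl fun i _ => ?_
    rw [← sub_add_cancel (s i * _) (chebyshevWordOption G s (G.eraseHead i u)), ← chebyshevWord_cons,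
      mul_add, map_add, ih, Nat.cast_add]
    cases G.eraseHead i u with
    | none => simp
    | some v => simp [ih]

lemma IsGIndepSemicircular.apply_sum_pow (hτ : IsFaithfulTracialState τ)
    (hs : IsGIndepSemicircular τ G s) (n : ℕ) :
    τ ((∑ i, s i) ^ n) = G.walkCount n [] := by
  simpa [chebyshevWord] using hs.apply_sum_pow_mul hτ n []

lemma IsGIndepSemicircular.isSelfAdjoint_sum (hs : IsGIndepSemicircular τ G s) :
    IsSelfAdjoint (∑ i, s i) :=
  _root_.isSelfAdjoint_sum _ fun i _ => (hs.semicircular i).selfAdjoint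

lemma IsGIndepSemicircular.walkCount_le (hτ : IsFaithfulTracialState τ)
    (hs : IsGIndepSemicircular τ G s) (n : ℕ) :
    (G.walkCount n [] : ℝ) ≤ ‖∑ i, s i‖ ^ n := by
  simpa [hs.apply_sum_pow hτ] using hτ.apply_pow_le hs.isSelfAdjoint_sum n

lemma IsGIndepSemicircular.norm_sum_le (hτ : IsFaithfulTracialState τ)
    (hs : IsGIndepSemicircular τ G s) {r C : ℝ} (hr : 0 ≤ r)
    (h : ∀ n, (G.walkCount n [] : ℝ) ≤ C * r ^ n) : ‖∑ i, s i‖ ≤ r :=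
  hτ.norm_le_of_apply_pow_le hs.isSelfAdjoint_sum hr fun n => by
    simpa [hs.apply_sum_pow hτ] using h n

lemma IsGIndepSemicircular.le_norm_sum (hτ : IsFaithfulTracialState τ)
    (hs : IsGIndepSemicircular τ G s) (h : List V → ℝ) {μ H : ℝ} (hμ : 0 ≤ μ) (K : ℕ)
    (hpos : 0 < h []) (h0 : ∀ u, h u ≤ H) (hK : ∀ u, K < u.length → h u ≤ 0)
    (hstep : ∀ u, μ * h u ≤ ∑ i, (h (i :: u) + (G.eraseHead i u).elim 0 h)) :
    μ ≤ ‖∑ i, s i‖ := by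
  have hH : 0 ≤ H := hpos.le.trans (h0 _)
  refine le_of_forall_pow_le (norm_nonneg _) hpos (C := H * ∑ k ∈ Finset.range (K + 1),
    ‖∑ i, s i‖ ^ k) fun n => ?_
  refine (G.le_walkCount_of_subsolution h μ H hμ K hH h0 hK hstep n []).trans ?_
  rw [mul_assoc, Finset.sum_mul]
  refine mul_le_mul_of_nonneg_left (Finset.sum_le_sum fun k _ => ?_) hH
  rw [mul_comm, ← pow_add]
  exact hs.walkCount_le hτ _

lemma norm_normalizedSum (s : V → A) :
    ‖normalizedSum s‖ = ‖∑ i, s i‖ / √(Fintype.card V : ℝ) := by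
  rw [normalizedSum, norm_smul, Complex.norm_real, Real.norm_of_nonneg (by positivity)]
  ring

end Moments

/-! ### The extremal graph: a clique and isolated vertices -/

section CliqueWithIsolated

variable {L ω : ℕ}

@[simp] lemma cliqueWithIsolated_adj_inl_inl (c d : Fin ω) :
    (cliqueWithIsolated L ω).Adj (.inl c) (.inl d) ↔ c ≠ d := by
  simp [cliqueWithIsolated]

@[simp] lemma cliqueWithIsolated_adj_inr_left (j : Fin (L - ω)) (x) :
    ¬ (cliqueWithIsolated L ω).Adj (.inr j) x := by
  cases x <;> simp [cliqueWithIsolated]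

@[simp] lemma cliqueWithIsolated_adj_inr_right (j : Fin (L - ω)) (x) :
    ¬ (cliqueWithIsolated L ω).Adj x (.inr j) := by
  cases x <;> simp [cliqueWithIsolated]

lemma cliqueNum_cliqueWithIsolated (hω : 1 ≤ ω) : (cliqueWithIsolated L ω).cliqueNum = ω := by
  classical
  apply le_antisymm
  · obtain ⟨s, hs⟩ := (cliqueWithIsolated L ω).exists_isNClique_cliqueNum
    rw [← hs.card_eq]
    by_cases h : ∃ j, Sum.inr j ∈ s
    · obtain ⟨j, hj⟩ := h
      refine le_trans (Finset.card_le_one.2 fun a ha b hb => ?_) hω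
      have key : ∀ a ∈ s, a = Sum.inr j := fun a ha => by
        by_contra hne
        exact cliqueWithIsolated_adj_inr_right j a (hs.isClique ha hj hne)
      rw [key a ha, key b hb]
    · push Not at h
      calc s.card ≤ (Finset.univ.map (Function.Embedding.inl : Fin ω ↪ _)).card := by
            refine Finset.card_le_card fun a ha => ?_
            rcases a with c | j
            · simp
            · exact absurd ha (h j)
        _ = ω := by simp
  · have hc : (cliqueWithIsolated L ω).IsClique
        (Finset.univ.map (Function.Embedding.inl : Fin ω ↪ Fin ω ⊕ Fin (L - ω))) := by
      intro a ha b hb hab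
      simp only [Finset.coe_map, Finset.coe_univ, Set.image_univ, Set.mem_range] at ha hb
      obtain ⟨c, rfl⟩ := ha
      obtain ⟨d, rfl⟩ := hb
      simpa using hab
    simpa using hc.card_le_cliqueNum

/-- A graph with a clique of size `ω` on `L` vertices contains the disjoint union of the complete
graph on `ω` vertices and isolated vertices. -/
lemma exists_equiv_cliqueWithIsolated {V : Type*} [Fintype V] (G : SimpleGraph V)
    (hV : Fintype.card V = L) (hG : G.cliqueNum = ω) :
    ∃ e : Fin ω ⊕ Fin (L - ω) ≃ V,
      ∀ i j, (cliqueWithIsolated L ω).Adj i j → G.Adj (e i) (e j) := by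
  classical
  obtain ⟨S, hS⟩ := G.exists_isNClique_cliqueNum
  rw [hG] at hS
  have e1 : Fin ω ≃ {x // x ∈ S} := (Fintype.equivFinOfCardEq (by simpa using hS.card_eq)).symm
  have e2 : Fin (L - ω) ≃ {x // ¬ x ∈ S} := (Fintype.equivFinOfCardEq (by
    rw [Fintype.card_subtype_compl, hV]; simp [hS.card_eq])).symm
  refine ⟨(Equiv.sumCongr e1 e2).trans (Equiv.sumCompl (· ∈ S)), fun i j hij => ?_⟩
  rcases i with c | i
  · rcases j with d | j
    · refine hS.isClique (by simp) (by simp) fun h => ?_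
      simp only [cliqueWithIsolated_adj_inl_inl] at hij
      exact hij (by simpa using h)
    · simp at hij
  · simp at hij

lemma eraseHead_inr_cons (i : Fin (L - ω)) (a) (u : List (Fin ω ⊕ Fin (L - ω))) :
    (cliqueWithIsolated L ω).eraseHead (.inr i) (a :: u) = if a = .inr i then some u else none := by
  split_ifs with h
  · simp [h]
  · exact SimpleGraph.eraseHead_cons_of_not_adj _ h (by simp) _

lemma eraseHead_inl_inr_cons (c : Fin ω) (j : Fin (L - ω)) (u : List (Fin ω ⊕ Fin (L - ω))) :
    (cliqueWithIsolated L ω).eraseHead (.inl c) (.inr j :: u) = none :=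
  SimpleGraph.eraseHead_cons_of_not_adj _ (by simp) (by simp) _

/-- Weight clique letters by `ω / Λ` and isolated ones by `1 / Λ`. The weights add up to `Λ`, which
accounts for additions. A word starting in the clique allows at most `ω` removals, each gaining `Λ /
ω`; one starting with an isolated letter allows a single removal, gaining `Λ`. Together this is `2 *
Λ`. -/
lemma walkCount_cliqueWithIsolated_le (hω : 1 ≤ ω) (hωL : ω ≤ L) (n : ℕ) :
    ((cliqueWithIsolated L ω).walkCount n [] : ℝ) ≤
      (2 * √((ω : ℝ) ^ 2 + L - ω)) ^ n := by
  have hω' : (1 : ℝ) ≤ ω := mod_cast hω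
  have hL' : (ω : ℝ) ≤ L := mod_cast hωL
  set Λ := √((ω : ℝ) ^ 2 + L - ω) with hΛ
  have hpos : (0 : ℝ) < (ω : ℝ) ^ 2 + L - ω := by nlinarith
  have hΛ0 : 0 < Λ := Real.sqrt_pos.2 hpos
  have hΛ2 : Λ * Λ = (ω : ℝ) ^ 2 + L - ω := Real.mul_self_sqrt hpos.le
  set wt : Fin ω ⊕ Fin (L - ω) → ℝ := Sum.elim (fun _ => ω / Λ) (fun _ => 1 / Λ) with hwt
  have hwt0 : ∀ i, 0 < wt i := by
    rintro (c | j) <;> simp only [hwt, Sum.elim_inl, Sum.elim_inr] <;> positivity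
  set h : List (Fin ω ⊕ Fin (L - ω)) → ℝ := fun u => (u.map wt).prod with hh
  have hcons : ∀ i u, h (i :: u) = wt i * h u := fun i u => by simp [hh]
  have h0 : ∀ u, 0 < h u := fun u => by
    induction u with
    | nil => simp [hh]
    | cons a u ih => rw [hcons]; exact mul_pos (hwt0 a) ih
  have herase : ∀ i u, ((cliqueWithIsolated L ω).eraseHead i u).elim 0 h ≤ h u / wt i := by
    intro i u
    cases hu : (cliqueWithIsolated L ω).eraseHead i u with
    | none => exact (div_pos (h0 u) (hwt0 i)).le
    | some v =>
      have := (((cliqueWithIsolated L ω).perm_of_eraseHead hu).map wt).prod_eq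
      rw [Option.elim_some, le_div_iff₀ (hwt0 i), mul_comm, ← hcons]
      exact this.ge
  have hadd : ∀ u, ∑ i, h (i :: u) = Λ * h u := by
    intro u
    simp only [hcons]
    rw [← Finset.sum_mul]
    congr 1
    simp only [hwt, Fintype.sum_sum_type, Sum.elim_inl, Sum.elim_inr, Finset.sum_const,
      Finset.card_univ, Fintype.card_fin, nsmul_eq_mul, Nat.cast_sub hωL]
    field_simp
    linarith
  have hrem : ∀ u, ∑ i, ((cliqueWithIsolated L ω).eraseHead i u).elim 0 h ≤ Λ * h u := by
    intro u
    rw [Fintype.sum_sum_type]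
    rcases u with _ | ⟨c | j, u⟩
    · simpa using (mul_pos hΛ0 (h0 [])).le
    · have h2 : ∑ i, ((cliqueWithIsolated L ω).eraseHead (.inr i) (.inl c :: u)).elim 0 h = 0 :=
        Finset.sum_eq_zero fun i _ => by simp [eraseHead_inr_cons]
      rw [h2, add_zero]
      refine (Finset.sum_le_sum fun d _ => herase (.inl d) (.inl c :: u)).trans (le_of_eq ?_)
      simp only [hwt, Sum.elim_inl, Finset.sum_const, Finset.card_univ, Fintype.card_fin,
        nsmul_eq_mul]
      field_simp
    · have h1 : ∑ i, ((cliqueWithIsolated L ω).eraseHead (.inl i) (.inr j :: u)).elim 0 h = 0 :=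
        Finset.sum_eq_zero fun i _ => by simp [eraseHead_inl_inr_cons]
      rw [h1, zero_add, Finset.sum_eq_single j]
      · refine (herase (.inr j) _).trans (le_of_eq ?_)
        simp only [hwt, Sum.elim_inr]
        field_simp
      · intro i _ hi
        simp [eraseHead_inr_cons, hi.symm]
      · simp
  have := (cliqueWithIsolated L ω).walkCount_le_of_supersolution h (2 * Λ) (by positivity)
    (fun u => (h0 u).le) (by simp [hh])
    (fun u => by
      rw [Finset.sum_add_distrib, hadd]
      linarith [hrem u]) n []
  simpa [hh] using this

variable {A : Type*} [CStarAlgebra A] {τ : A →ₗ[ℂ] ℂ} {s : Fin ω ⊕ Fin (L - ω) → A}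

/-- The isolated vertices alone force the norm of the sum to be at least `√(2 (L - ω))`. -/
lemma sqrt_isolated_le_norm_sum (hτ : IsFaithfulTracialState τ)
    (hs : IsGIndepSemicircular τ (cliqueWithIsolated L ω) s) :
    √(2 * (L - ω : ℕ)) ≤ ‖∑ i, s i‖ := by
  rcases Nat.eq_zero_or_pos (L - ω) with hv | hv
  · simp [hv]
  have hv' : (0 : ℝ) < (L - ω : ℕ) := mod_cast hv
  set v : ℝ := ((L - ω : ℕ) : ℝ) with hvdef
  set μ := √(2 * v) with hμ
  have hμ0 : 0 < μ := Real.sqrt_pos.2 (by positivity)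
  have hμ2 : μ * μ = 2 * v := Real.mul_self_sqrt (by positivity)
  -- On words of isolated letters there are `v` additions and, unless the word is empty, one
  -- removal. These values solve `μ ψ₀ = v ψ₁`, `μ ψ₁ = v ψ₂ + ψ₀`, `μ ψ₂ = ψ₁` with `μ ^ 2 = 2 v`.
  set ψ : ℕ → ℝ := fun k => match k with
    | 0 => 1
    | 1 => μ / v
    | 2 => 1 / v
    | _ => 0 with hψ
  have hψ0 : ∀ k, 0 ≤ ψ k := fun k => by
    match k with
    | 0 => simp [hψ]
    | 1 => simp only [hψ]; positivity
    | 2 => simp only [hψ]; positivity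
    | k + 3 => simp [hψ]
  set h : List (Fin ω ⊕ Fin (L - ω)) → ℝ := fun u => if ∀ a ∈ u, a.isRight then ψ u.length else 0
    with hh
  have h0 : ∀ u, 0 ≤ h u := fun u => by
    simp only [hh]; split_ifs; exacts [hψ0 _, le_rfl]
  have h0' : ∀ o : Option (List (Fin ω ⊕ Fin (L - ω))), 0 ≤ o.elim 0 h := fun o => by
    cases o; exacts [le_rfl, h0 _]
  refine hs.le_norm_sum hτ h (H := 1 + μ / v + 1 / v) hμ0.le 2 (by simp [hh, hψ])
    (fun u => ?_) (fun u hu => ?_) (fun u => ?_)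
  · have a1 : 0 ≤ μ / v := by positivity
    have a2 : 0 ≤ 1 / v := by positivity
    simp only [hh]
    split_ifs
    · rcases u.length with _ | _ | _ | k <;> simp only [hψ] <;> linarith
    · linarith
  · simp only [hh]
    split_ifs
    · obtain ⟨k, hk⟩ := Nat.exists_eq_add_of_le hu
      rw [hk, show (2 : ℕ).succ + k = k + 3 by omega]
      exact le_rfl
    · exact le_rfl
  · by_cases hu : ∀ a ∈ u, a.isRight
    swap
    · simp only [hh, if_neg hu, mul_zero]
      exact Finset.sum_nonneg fun i _ => add_nonneg (h0 _) (h0' _)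
    rw [Finset.sum_add_distrib]
    have hadd : v * ψ (u.length + 1) ≤ ∑ i, h (i :: u) := by
      rw [Fintype.sum_sum_type]
      refine le_add_of_nonneg_of_le (Finset.sum_nonneg fun i _ => h0 _) (le_of_eq ?_)
      have : ∀ j : Fin (L - ω), h (.inr j :: u) = ψ (u.length + 1) := fun j => by
        simp only [hh]
        rw [if_pos (by simpa using hu), List.length_cons]
      simp [this, hvdef]
    have hu' : h u = ψ u.length := if_pos hu
    rw [hu']
    refine le_trans ?_ (add_le_add_left hadd _)
    rcases u with _ | ⟨c | j, u⟩
    · simp only [hψ, List.length_nil]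
      refine le_add_of_le_of_nonneg (le_of_eq (by field_simp)) (Finset.sum_nonneg fun i _ => h0' _)
    · simp at hu
    · have hrem : ψ u.length ≤ ∑ i, ((cliqueWithIsolated L ω).eraseHead i (.inr j :: u)).elim 0 h := by
        refine le_trans (le_of_eq ?_)
          (Finset.single_le_sum (fun i _ => h0' _) (Finset.mem_univ (Sum.inr j)))
        simp only [SimpleGraph.eraseHead_cons_self, Option.elim_some, hh]
        rw [if_pos fun a ha => hu a (List.mem_cons_of_mem _ ha)]
      refine le_trans ?_ (add_le_add_right hrem _)
      rw [List.length_cons]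
      rcases u.length with _ | _ | k
      · simp only [hψ]
        rw [← mul_div_assoc, hμ2]
        field_simp
        norm_num
      · simp only [hψ]
        ring_nf
        exact le_rfl
      · have : 0 ≤ v * ψ (k + 1 + 1 + 1 + 1) + ψ (k + 1 + 1) :=
          add_nonneg (mul_nonneg hv'.le (hψ0 (k + 4))) (hψ0 _)
        simpa [hψ] using this

/-- The clique alone forces the norm of the sum to be at least `√2 ω`. -/
lemma sqrt_two_mul_clique_le_norm_sum (hτ : IsFaithfulTracialState τ)
    (hs : IsGIndepSemicircular τ (cliqueWithIsolated L ω) s) :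
    √2 * ω ≤ ‖∑ i, s i‖ := by
  classical
  have h22 : √2 * √2 = (2 : ℝ) := Real.mul_self_sqrt (by norm_num)
  have h12 : √2 ≤ (2 : ℝ) := Real.sqrt_le_iff.2 (by norm_num)
  -- Eigenvector `(1, √2, 1)` of the path on three vertices, with eigenvalue `√2`. In the clique
  -- every letter present is accessible, so the letter counts move independently and each letter
  -- contributes `√2`.
  set φ : ℕ → ℝ := fun k => match k with
    | 0 => 1
    | 1 => √2
    | 2 => 1
    | _ => 0 with hφ
  have hφ0 : ∀ k, 0 ≤ φ k := fun k => by
    match k with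
    | 0 => simp [hφ]
    | 1 => simp [hφ]
    | 2 => simp [hφ]
    | k + 3 => simp [hφ]
  have hφ2 : ∀ k, φ k ≤ 2 := fun k => by
    match k with
    | 0 => simp [hφ]
    | 1 => exact h12
    | 2 => simp [hφ]
    | k + 3 => simp [hφ]
  obtain ⟨cnt, cnt_nil, cnt_cons, cnt_perm⟩ : ∃ cnt : Fin ω → List (Fin ω ⊕ Fin (L - ω)) → ℕ,
      (∀ c, cnt c [] = 0) ∧
      (∀ c d u, cnt c (.inl d :: u) = cnt c u + if d = c then 1 else 0) ∧
      ∀ c u v, u.Perm v → cnt c u = cnt c v :=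
    ⟨fun c u => u.countP (· = .inl c), by simp, by simp [List.countP_cons],
      fun c u v h => h.countP_eq _⟩
  set h : List (Fin ω ⊕ Fin (L - ω)) → ℝ := fun u =>
    if ∀ a ∈ u, a.isLeft then ∏ c, φ (cnt c u) else 0 with hh
  have h0 : ∀ u, 0 ≤ h u := fun u => by
    simp only [hh]; split_ifs; exacts [Finset.prod_nonneg fun _ _ => hφ0 _, le_rfl]
  have h0' : ∀ o : Option (List (Fin ω ⊕ Fin (L - ω))), 0 ≤ o.elim 0 h := fun o => by
    cases o; exacts [le_rfl, h0 _]
  have hlen : ∀ u : List (Fin ω ⊕ Fin (L - ω)), (∀ a ∈ u, a.isLeft) →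
      u.length = ∑ c, cnt c u := by
    intro u hu
    induction u with
    | nil => simp [cnt_nil]
    | cons a u ih =>
      obtain ⟨c, rfl⟩ := Sum.isLeft_iff.1 (hu a (by simp))
      simp [cnt_cons, Finset.sum_add_distrib, ← ih fun a ha => hu a (by simp [ha])]
  refine hs.le_norm_sum hτ h (H := 2 ^ ω) (by positivity) (2 * ω) (by simp [hh, hφ, cnt_nil])
    (fun u => ?_) (fun u hu => ?_) (fun u => ?_)
  · simp only [hh]
    split_ifs
    · refine (Finset.prod_le_prod (fun _ _ => hφ0 _) fun _ _ => hφ2 _).trans (by simp)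
    · positivity
  · simp only [hh]
    split_ifs with hl
    · rw [hlen u hl] at hu
      -- More than `2 * ω` letters force some letter to occur at least three times, where `φ`
      -- vanishes.
      obtain ⟨c, -, hc⟩ : ∃ c ∈ (Finset.univ : Finset (Fin ω)), 2 < cnt c u := by
        refine Finset.exists_lt_of_sum_lt (f := fun _ => 2) ?_
        simpa [mul_comm] using hu
      rw [Finset.prod_eq_zero (Finset.mem_univ c)]
      obtain ⟨k, hk⟩ := Nat.exists_eq_add_of_le hc
      rw [hk, show (2 : ℕ).succ + k = k + 3 by omega]
      rfl
    · exact le_rfl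
  · by_cases hu : ∀ a ∈ u, a.isLeft
    swap
    · simp only [hh, if_neg hu, mul_zero]
      exact Finset.sum_nonneg fun i _ => add_nonneg (h0 _) (h0' _)
    rw [Fintype.sum_sum_type]
    refine le_add_of_le_of_nonneg ?_ (Finset.sum_nonneg fun i _ => add_nonneg (h0 _) (h0' _))
    have key : ∀ c : Fin ω, √2 * h u ≤ h (.inl c :: u) +
        ((cliqueWithIsolated L ω).eraseHead (.inl c) u).elim 0 h := by
      intro c
      set R := ∏ d ∈ Finset.univ.erase c, φ (cnt d u) with hR
      have hR0 : 0 ≤ R := Finset.prod_nonneg fun _ _ => hφ0 _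
      have hval : ∀ w : List (Fin ω ⊕ Fin (L - ω)), (∀ a ∈ w, a.isLeft) →
          (∀ d, d ≠ c → cnt d w = cnt d u) →
          h w = φ (cnt c w) * R := by
        intro w hw hd
        simp only [hh, if_pos hw]
        rw [← Finset.mul_prod_erase _ _ (Finset.mem_univ c), hR]
        congr 1
        exact Finset.prod_congr rfl fun d hd' => by rw [hd d (Finset.ne_of_mem_erase hd')]
      have e1 := hval u hu fun _ _ => rfl
      have e2 := hval (.inl c :: u) (by simpa using hu) fun d hd => by
        simp [cnt_cons, hd.symm]
      rw [cnt_cons, if_pos rfl] at e2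
      rw [e1, e2]
      by_cases hc : Sum.inl c ∈ u
      · obtain ⟨w, hw⟩ := (cliqueWithIsolated L ω).exists_eraseHead hc fun a ha hne => by
          obtain ⟨d, rfl⟩ := Sum.isLeft_iff.1 (hu a ha)
          simpa [eq_comm] using hne
        have hp := (cliqueWithIsolated L ω).perm_of_eraseHead hw
        have e3 := hval w (fun a ha => hu a (hp.mem_iff.2 (by simp [ha]))) fun d hd => by
          rw [cnt_perm d u _ hp]
          simp [cnt_cons, hd.symm]
        rw [hw, Option.elim_some, e3, cnt_perm c u _ hp, cnt_cons, if_pos rfl, ← add_mul, ← mul_assoc]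
        refine mul_le_mul_of_nonneg_right ?_ hR0
        rcases cnt c w with _ | _ | k
        · simp only [hφ]
          rw [h22]
          norm_num
        · simp [hφ]
        · simpa [hφ] using hφ0 (k + 1 + 1)
      · have hz : ∀ w : List (Fin ω ⊕ Fin (L - ω)), (∀ a ∈ w, a.isLeft) → Sum.inl c ∉ w →
            cnt c w = 0 := by
          intro w hw hcw
          induction w with
          | nil => exact cnt_nil c
          | cons a w ih =>
            obtain ⟨d, rfl⟩ := Sum.isLeft_iff.1 (hw a (by simp))
            simp only [List.mem_cons, Sum.inl.injEq, not_or] at hcw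
            rw [cnt_cons, if_neg (Ne.symm hcw.1), ih (fun a ha => hw a (by simp [ha])) hcw.2]
        rw [hz u hu hc]
        refine le_add_of_le_of_nonneg (le_of_eq ?_) (h0' _)
        simp [hφ]
    calc √2 * ω * h u = ∑ _c : Fin ω, √2 * h u := by simp; ring
      _ ≤ _ := Finset.sum_le_sum fun c _ => key c

/-- A sum of two reals is at most twice the larger, applied to `ω ^ 2` and `L - ω`. -/
lemma sqrt_le_norm_sum_cliqueWithIsolated (hωL : ω ≤ L) (hτ : IsFaithfulTracialState τ)
    (hs : IsGIndepSemicircular τ (cliqueWithIsolated L ω) s) :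
    √((ω : ℝ) ^ 2 + L - ω) ≤ ‖∑ i, s i‖ := by
  rcases le_total ((ω : ℝ) ^ 2) (L - ω : ℕ) with h | h
  · refine le_trans (Real.sqrt_le_sqrt ?_) (sqrt_isolated_le_norm_sum hτ hs)
    rw [Nat.cast_sub hωL] at h ⊢
    linarith
  · refine le_trans (Real.sqrt_le_iff.2 ⟨by positivity, ?_⟩)
      (sqrt_two_mul_clique_le_norm_sum hτ hs)
    rw [Nat.cast_sub hωL] at h
    rw [mul_pow, Real.sq_sqrt (by norm_num)]
    linarith

end CliqueWithIsolated

theorem proposition1p3 (L ω : ℕ) (hω : 1 ≤ ω) (hωL : ω ≤ L)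
    {B : Type*} [CStarAlgebra B] (σ : B →ₗ[ℂ] ℂ) (hσ : IsFaithfulTracialState σ)
    (t : Fin ω ⊕ Fin (L - ω) → B)
    (ht : IsGIndepSemicircular σ (cliqueWithIsolated L ω) t) :
    (cliqueWithIsolated L ω).cliqueNum = ω ∧
    (∀ (V : Type*) [Fintype V] (G : SimpleGraph V), Fintype.card V = L → G.cliqueNum = ω →
      ∀ (A : Type*) [CStarAlgebra A] (τ : A →ₗ[ℂ] ℂ), IsFaithfulTracialState τ →
      ∀ s : V → A, IsGIndepSemicircular τ G s →
        ‖normalizedSum t‖ ≤ ‖normalizedSum s‖) ∧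
    √(((ω : ℝ) ^ 2 + L - ω) / L) ≤ ‖normalizedSum t‖ ∧
    ‖normalizedSum t‖ ≤ 2 * √(((ω : ℝ) ^ 2 + L - ω) / L) := by
  have hcard : Fintype.card (Fin ω ⊕ Fin (L - ω)) = L := by simp [hωL]
  refine ⟨cliqueNum_cliqueWithIsolated hω, ?_, ?_, ?_⟩
  · intro V _ G hV hG A _ τ hτ s hs
    obtain ⟨e, he⟩ := exists_equiv_cliqueWithIsolated G hV hG
    rw [norm_normalizedSum, norm_normalizedSum, hV, hcard]
    refine div_le_div_of_nonneg_right ?_ (Real.sqrt_nonneg _)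
    refine ht.norm_sum_le hσ (norm_nonneg _) (C := 1) fun n => ?_
    rw [one_mul]
    refine le_trans ?_ (hs.walkCount_le hτ n)
    exact_mod_cast SimpleGraph.walkCount_le_of_equiv e he n []
  · rw [norm_normalizedSum, hcard, Real.sqrt_div' _ (Nat.cast_nonneg L)]
    exact div_le_div_of_nonneg_right (sqrt_le_norm_sum_cliqueWithIsolated hωL hσ ht)
      (Real.sqrt_nonneg _)
  · rw [norm_normalizedSum, hcard, Real.sqrt_div' _ (Nat.cast_nonneg L), ← mul_div_assoc]
    refine div_le_div_of_nonneg_right ?_ (Real.sqrt_nonneg _)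
    refine ht.norm_sum_le hσ (by positivity) (C := 1) fun n => ?_
    rw [one_mul]
    exact walkCount_cliqueWithIsolated_le hω hωL n
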